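/- Let $p$ be a natural number, let $S=(S_{ij})$ be a real symmetric positive semidefinite $p\times p$ matrix (for example a sample covariance matrix) with $S_{ii}>0$ for all $i$ and $S_{ij}<\sqrt{S_{ii}S_{jj}}$ for all $i\ne j$, and let $\Lambda=(\Lambda_{ij})$ be a real symmetric $p\times p$ matrix with $\Lambda_{ij}\ge 0$ for all $i\neq j$. Let $\mathcal M^p$ be the set of real symmetric positive definite $p\times p$ matrices $\Theta$ with $\Theta_{ij}\le 0$ for all $i\ne j$, and consider the problem $$\min_{\Theta\in\mathcal M^p}\; -\log\det\Theta+\sum_{i,j}\Theta_{ij}S_{ij}+\sum_{i\ne j}\Lambda_{ij}|\Theta_{ij}| .$$ Let $T$ be the thresholded matrix, $T_{ij}=S_{ij}-\Lambda_{ij}$ if $i\ne j$ and $S_{ij}>\Lambda_{ij}$, and $T_{ij}=0$ otherwise. For a symmetric matrix $A$, let $\mathrm{supp}(A)$ be the undirected graph on $\{1,\dots,p\}$ in which distinct vertices $i,j$ are adjacent if and only if $A_{ij}\neq 0$. Let $\mathcal N(i)$ be the set of neighbors of $i$ in $\mathrm{supp}(T)$, and let $\mathcal B$ be the set of pairs $(i,j)$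 that are bridges of $\mathrm{supp}(T)$, that is, edges whose deletion increases the number of connected components. Suppose that $\mathrm{supp}(T)$ is acyclic (so that $\mathcal B$ consists of all its edges). Then the problem has exactly one minimizer $\Theta^\star$, the graph $\mathrm{supp}(\Theta^\star)$ is acyclic, and $$\Theta^\star_{ij}=\begin{cases}\dfrac1{S_{ii}}\Bigl(1+\displaystyle\sum_{m\in\mathcal N(i)}\dfrac{T_{im}^2}{S_{ii}S_{mm}-T_{im}^2}\Bigr)&\text{if } i=j,\\[2ex]-\dfrac{T_{ij}}{S_{ii}S_{jj}-T_{ij}^2}&\text{if }(i,j)\in\mathcal B,\\[1ex]0&\text{otherwise.}\end{cases}$$ -/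

import Mathlib

/-- The set `𝓜^p` of symmetric positive definite `p × p` real matrices with non-positive
off-diagonal entries. (For real matrices `Matrix.PosDef` includes symmetry.) -/
def MMatrices (p : ℕ) : Set (Matrix (Fin p) (Fin p) ℝ) :=
  {Θ | Θ.PosDef ∧ ∀ i j, i ≠ j → Θ i j ≤ 0}

/-- The objective `-log det Θ + ⟨Θ, S⟩ + ∑_{i ≠ j} Λ_ij |Θ_ij|`. -/
noncomputable def objective {p : ℕ} (S Λ Θ : Matrix (Fin p) (Fin p) ℝ) : ℝ :=
  -Real.log Θ.det + ∑ i, ∑ j, Θ i j * S i j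
    + ∑ i, ∑ j, if i ≠ j then Λ i j * |Θ i j| else 0

/-- `Θ` is an optimal solution: a minimizer of the objective over `𝓜^p`. -/
def IsOptimal {p : ℕ} (S Λ Θ : Matrix (Fin p) (Fin p) ℝ) : Prop :=
  Θ ∈ MMatrices p ∧ ∀ Θ' ∈ MMatrices p, objective S Λ Θ ≤ objective S Λ Θ'

/-- The thresholded sample covariance matrix `T`. -/
noncomputable def thresholded {p : ℕ} (S Λ : Matrix (Fin p) (Fin p) ℝ) :
    Matrix (Fin p) (Fin p) ℝ :=
  Matrix.of fun i j => if i ≠ j ∧ Λ i j < S i j then S i j - Λ i j else 0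

/-- The support graph of a symmetric matrix `A`: distinct `i`, `j` are adjacent iff `A i j ≠ 0`
(see `supportGraph_adj`). -/
def supportGraph {p : ℕ} (A : Matrix (Fin p) (Fin p) ℝ) : SimpleGraph (Fin p) :=
  SimpleGraph.fromRel fun i j => A i j ≠ 0

theorem supportGraph_adj {p : ℕ} {A : Matrix (Fin p) (Fin p) ℝ} (hA : A.IsSymm) (i j : Fin p) :
    (supportGraph A).Adj i j ↔ i ≠ j ∧ A i j ≠ 0 := by
  simp [supportGraph, hA.apply i j]

/-- `(i, j)` is a bridge of `G`: an edge whose deletion disconnects its endpoints, equivalently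
increases the number of components. (`SimpleGraph.IsBridge` alone does not require `(i, j)` to be
an edge.) -/
def BridgePair {p : ℕ} (G : SimpleGraph (Fin p)) (i j : Fin p) : Prop :=
  G.Adj i j ∧ G.IsBridge s(i, j)

open Classical in
/-- The closed-form matrix; in the first case the sum runs over the neighbors `m` of `i` in the
thresholded graph. -/
noncomputable def closedForm {p : ℕ} (S Λ : Matrix (Fin p) (Fin p) ℝ) :
    Matrix (Fin p) (Fin p) ℝ :=
  let T := thresholded S Λ
  let G := supportGraph T
  Matrix.of fun i j =>
    if i = j then
      1 / S i i * (1 + ∑ m with G.Adj i m, T i m ^ 2 / (S i i * S m m - T i m ^ 2))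
    else if BridgePair G i j then
      -(T i j / (S i i * S j j - T i j ^ 2))
    else 0

open Matrix in
theorem Matrix.PosDef.log_det_lt_trace_sub_card {n : Type*} [Fintype n] [DecidableEq n]
    {A : Matrix n n ℝ} (hA : A.PosDef) (hne : A ≠ 1) :
    Real.log A.det < A.trace - Fintype.card n := by
  have hdet := hA.1.det_eq_prod_eigenvalues
  have htr := hA.1.trace_eq_sum_eigenvalues
  simp only [RCLike.ofReal_real_eq_id, id_eq] at hdet htr
  rw [hdet, htr, Real.log_prod (fun i _ => (hA.eigenvalues_pos i).ne')]
  have hex : ∃ i, hA.1.eigenvalues i ≠ 1 := by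
    by_contra! h
    apply hne
    have hd : diagonal (RCLike.ofReal ∘ hA.1.eigenvalues : n → ℝ) = 1 := by
      ext i j
      simp [diagonal_apply, one_apply, h]
    have h := hA.1.spectral_theorem
    rw [hd] at h
    simpa using h
  have hcard : (Fintype.card n : ℝ) = ∑ _i : n, (1 : ℝ) := by simp
  rw [hcard, ← Finset.sum_sub_distrib]
  obtain ⟨i, hi⟩ := hex
  exact Finset.sum_lt_sum (fun j _ => Real.log_le_sub_one_of_pos (hA.eigenvalues_pos j))
    ⟨i, Finset.mem_univ _, Real.log_lt_sub_one_of_pos (hA.eigenvalues_pos i) hi⟩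

open Matrix MatrixOrder in
/-- Strict concavity of `log det`, as a tangent inequality at `K` with `K⁻¹ = C`. -/
theorem Matrix.PosDef.log_det_lt_log_det_add {n : Type*} [Fintype n] [DecidableEq n]
    {Θ K C : Matrix n n ℝ} (hΘ : Θ.PosDef) (hC : C.PosDef) (hKC : K * C = 1) (hne : Θ ≠ K) :
    Real.log Θ.det < Real.log K.det + ((Θ - K) * C).trace := by
  obtain ⟨B, hB, hCB⟩ : ∃ B : Matrix n n ℝ, IsUnit B ∧ C = Bᴴ * B := by
    obtain ⟨B, rfl⟩ := CStarAlgebra.nonneg_iff_eq_star_mul_self.mp hC.posSemidef.nonneg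
    refine ⟨B, ?_, rfl⟩
    have h := hC.det_pos
    rw [Matrix.star_eq_conjTranspose, Matrix.det_mul] at h
    exact (Matrix.isUnit_iff_isUnit_det _).2 (isUnit_iff_ne_zero.2 (right_ne_zero_of_mul h.ne'))
  have hM : (B * Θ * Bᴴ).PosDef := by
    have := (Matrix.IsUnit.posDef_star_right_conjugate_iff (x := Θ) hB).2 hΘ
    simpa [Matrix.star_eq_conjTranspose] using this
  have hdet : (B * Θ * Bᴴ).det = Θ.det * C.det := by
    rw [hCB]
    simp only [Matrix.det_mul]
    ring
  have htr : (B * Θ * Bᴴ).trace = (Θ * C).trace := by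
    rw [hCB, Matrix.trace_mul_cycle, Matrix.trace_mul_comm]
  have hMne : B * Θ * Bᴴ ≠ 1 := by
    intro h
    apply hne
    have h1 : Θ * C = 1 := by
      have h2 : Bᴴ * (B * Θ) = 1 := mul_eq_one_comm.1 h
      rw [hCB]
      exact mul_eq_one_comm.1 (by rw [Matrix.mul_assoc, h2])
    have h3 : C * K = 1 := mul_eq_one_comm.1 hKC
    calc Θ = Θ * (C * K) := by rw [h3, Matrix.mul_one]
      _ = K := by rw [← Matrix.mul_assoc, h1, Matrix.one_mul]
  have hlt := hM.log_det_lt_trace_sub_card hMne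
  have hK : K.det * C.det = 1 := by rw [← Matrix.det_mul, hKC, Matrix.det_one]
  have hKdet : Real.log K.det = - Real.log C.det := by
    rw [eq_inv_of_mul_eq_one_left hK, Real.log_inv]
  rw [hdet, htr, Real.log_mul hΘ.det_pos.ne' hC.det_pos.ne'] at hlt
  rw [hKdet, Matrix.sub_mul, hKC, Matrix.trace_sub, Matrix.trace_one]
  linarith

open Classical in
/-- The precision matrix attached to a forest `G` with variances `s` and edge covariances `T`. -/
noncomputable def forestPrecision {n : Type*} [Fintype n] (s : n → ℝ) (T : Matrix n n ℝ)
    (G : SimpleGraph n) : Matrix n n ℝ :=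
  Matrix.of fun i j =>
    if i = j then 1 / s i * (1 + ∑ m with G.Adj i m, T i m ^ 2 / (s i * s m - T i m ^ 2))
    else if G.Adj i j then -(T i j / (s i * s j - T i j ^ 2))
    else 0

/-- `C` is a covariance matrix of a nonnegatively correlated Gaussian Markov forest on `G`. -/
structure IsForestCovariance {n : Type*} [Fintype n] [DecidableEq n] (s : n → ℝ)
    (T : Matrix n n ℝ) (G : SimpleGraph n) (C : Matrix n n ℝ) : Prop where
  posDef : C.PosDef
  diag : ∀ i, C i i = s i
  adj : ∀ i j, G.Adj i j → C i j = T i j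
  nonneg : ∀ i j, 0 ≤ C i j
  reachable : ∀ i j, C i j ≠ 0 → G.Reachable i j
  precision_mul : forestPrecision s T G * C = 1

section

variable {n : Type*} [Fintype n] [DecidableEq n]

theorem isForestCovariance_bot {s : n → ℝ} (hs : ∀ i, 0 < s i) (T : Matrix n n ℝ) :
    IsForestCovariance s T ⊥ (Matrix.diagonal s) where
  posDef := Matrix.posDef_diagonal_iff.2 hs
  diag := by simp
  adj := by simp
  nonneg i j := by
    rw [Matrix.diagonal_apply]
    split_ifs
    exacts [(hs i).le, le_rfl]
  reachable i j h := by
    rw [Matrix.diagonal_apply] at h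
    simp only [ne_eq, ite_eq_right_iff, Classical.not_imp] at h
    rw [h.1]
  precision_mul := by
    ext i j
    rw [Matrix.mul_diagonal, Matrix.one_apply]
    by_cases h : i = j
    · subst h
      simp [forestPrecision, (hs i).ne']
    · simp [forestPrecision, h]

theorem sum_filter_adj_deleteEdges {G : SimpleGraph n} {u v : n} (huv : G.Adj u v) (f : n → ℝ)
    [DecidablePred fun m => G.Adj u m] [DecidablePred fun m => (G.deleteEdges {s(u, v)}).Adj u m] :
    ∑ m with G.Adj u m, f m = ∑ m with (G.deleteEdges {s(u, v)}).Adj u m, f m + f v := by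
  have : ({m | G.Adj u m} : Finset n) =
      insert v ({m | (G.deleteEdges {s(u, v)}).Adj u m} : Finset n) := by
    ext m
    simp only [SimpleGraph.deleteEdges_adj, Finset.mem_filter, Finset.mem_univ, true_and,
      Finset.mem_insert, Set.mem_singleton_iff, Sym2.eq_iff]
    by_cases h : m = v
    · simp [h, huv]
    · have := huv.ne
      simp [h, this]
  rw [this, Finset.sum_insert (by simp), add_comm]

theorem forestPrecision_deleteEdges_add {s : n → ℝ} {T : Matrix n n ℝ} (hT : T.IsSymm)
    {G : SimpleGraph n} {u v : n} (huv : G.Adj u v) :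
    forestPrecision s T G = forestPrecision s T (G.deleteEdges {s(u, v)})
      + (Matrix.single u u (1 / s u * (T u v ^ 2 / (s u * s v - T u v ^ 2)))
      + Matrix.single v v (1 / s v * (T u v ^ 2 / (s u * s v - T u v ^ 2)))
      + Matrix.single u v (-(T u v / (s u * s v - T u v ^ 2)))
      + Matrix.single v u (-(T u v / (s u * s v - T u v ^ 2)))) := by
  classical
  have hne := huv.ne
  ext i j
  by_cases hij : i = j
  · subst hij
    by_cases hu : u = i
    · subst hu
      simp only [forestPrecision, Matrix.of_apply, if_true, Matrix.add_apply,
        sum_filter_adj_deleteEdges huv]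
      simp [hne.symm]
      ring
    by_cases hv : v = i
    · subst hv
      simp only [forestPrecision, Matrix.of_apply, if_true, Matrix.add_apply,
        sum_filter_adj_deleteEdges huv.symm, Sym2.eq_swap (a := u)]
      simp [hne, hT.apply, mul_comm (s v)]
      ring
    · have : ∀ m, (G.deleteEdges {s(u, v)}).Adj i m ↔ G.Adj i m := by
        intro m
        simp [Ne.symm hu, Ne.symm hv]
      simp [forestPrecision, this, hu, hv, -SimpleGraph.deleteEdges_adj]
  · by_cases h1 : i = u ∧ j = v
    · obtain ⟨rfl, rfl⟩ := h1
      simp [forestPrecision, huv, hij, Ne.symm hij]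
    by_cases h2 : i = v ∧ j = u
    · obtain ⟨rfl, rfl⟩ := h2
      simp [forestPrecision, huv.symm, hij, Ne.symm hij, hT.apply,
        mul_comm (s i)]
    · have h3 : ¬ (u = i ∧ v = j) := fun h => h1 ⟨h.1.symm, h.2.symm⟩
      have h4 : ¬ (v = i ∧ u = j) := fun h => h2 ⟨h.1.symm, h.2.symm⟩
      have h5 : ¬ (u = i ∧ u = j) := fun h => hij (h.1.symm.trans h.2)
      have h6 : ¬ (v = i ∧ v = j) := fun h => hij (h.1.symm.trans h.2)
      have h7 : (G.deleteEdges {s(u, v)}).Adj i j ↔ G.Adj i j := by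
        rw [SimpleGraph.deleteEdges_adj, Set.mem_singleton_iff, Sym2.eq_iff]
        simp [h1, h2]
      simp [forestPrecision, hij, h3, h4, h5, h6, h7, -SimpleGraph.deleteEdges_adj]

open Matrix in
theorem Matrix.PosDef.add_cross_outer {C : Matrix n n ℝ} (hC : C.PosDef) {u v : n}
    (huv : C u v = 0) {t c : ℝ} (ht : t ^ 2 < C u u * C v v) (hc : c * (C u u * C v v) = t) :
    (C + C * (single u v c + single v u c) * C).PosDef := by
  have hsymm : C.IsSymm := hC.1
  have hu : 0 < C u u := hC.diag_pos
  have hv : 0 < C v v := hC.diag_pos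
  have hvu : C v u = 0 := by rw [hsymm.apply, huv]
  refine .of_dotProduct_mulVec_pos ?_ fun x hx => ?_
  · refine hC.1.add ?_
    have h := Matrix.isHermitian_mul_mul_conjTranspose C
      (A := single u v c + single v u c) (by
        rw [IsHermitian, conjTranspose_add]
        simp [add_comm])
    rwa [hC.1.eq] at h
  set α := (C *ᵥ x) u
  set β := (C *ᵥ x) v
  have hq : x ⬝ᵥ ((C + C * (single u v c + single v u c) * C) *ᵥ x)
      = x ⬝ᵥ (C *ᵥ x) + 2 * c * α * β := by
    have hx' : x ᵥ* C = C *ᵥ x := by rw [← mulVec_transpose, hsymm.eq]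
    rw [add_mulVec, dotProduct_add, ← mulVec_mulVec, ← mulVec_mulVec,
      dotProduct_mulVec x C ((single u v c + single v u c) *ᵥ _), hx', add_mulVec, dotProduct_add]
    simp only [single_mulVec, ← Pi.single.eq_1, dotProduct_single, α, β]
    ring
  have hb : α ^ 2 / C u u + β ^ 2 / C v v ≤ x ⬝ᵥ (C *ᵥ x) := by
    set w : n → ℝ := Pi.single u (α / C u u) + Pi.single v (β / C v v) with hw
    have h := hC.posSemidef.dotProduct_mulVec_nonneg (x - w)
    have h1 : w ⬝ᵥ (C *ᵥ x) = α ^ 2 / C u u + β ^ 2 / C v v := by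
      rw [hw, add_dotProduct, single_dotProduct, single_dotProduct]
      ring
    have h2 : x ⬝ᵥ (C *ᵥ w) = w ⬝ᵥ (C *ᵥ x) := by
      rw [dotProduct_mulVec, ← mulVec_transpose, hsymm.eq, dotProduct_comm]
    have h3 : w ⬝ᵥ (C *ᵥ w) = α ^ 2 / C u u + β ^ 2 / C v v := by
      rw [hw, add_dotProduct, single_dotProduct, single_dotProduct]
      simp only [mulVec_add, Pi.add_apply, mulVec_single, huv, hvu, Matrix.col_apply,
        Pi.smul_apply, MulOpposite.smul_eq_mul_unop, MulOpposite.unop_op]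
      field_simp
      ring
    rw [star_trivial, mulVec_sub, dotProduct_sub, sub_dotProduct, sub_dotProduct, h2, h3, h1] at h
    linarith
  have hpos : 0 < x ⬝ᵥ (C *ᵥ x) := by simpa using hC.dotProduct_mulVec_pos hx
  rw [star_trivial, hq]
  by_cases hαβ : α * β = 0
  · rw [mul_assoc, hαβ]
    simpa using hpos
  · have hlt : 0 < α ^ 2 / C u u + β ^ 2 / C v v + 2 * c * α * β := by
      have hα : α ≠ 0 := left_ne_zero_of_mul hαβ
      have hβ : 0 < β ^ 2 := by have := right_ne_zero_of_mul hαβ; positivity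
      have heq : α ^ 2 / C u u + β ^ 2 / C v v + 2 * c * α * β
          = ((α * C v v + t * β) ^ 2 + (C u u * C v v - t ^ 2) * β ^ 2)
            / (C u u * C v v ^ 2) := by
        rw [← hc]
        field_simp
        ring
      rw [heq]
      have : 0 < (C u u * C v v - t ^ 2) * β ^ 2 := mul_pos (by linarith) hβ
      positivity
    linarith

theorem IsForestCovariance.of_deleteEdges {s : n → ℝ} {T : Matrix n n ℝ} (hT : T.IsSymm)
    {G : SimpleGraph n} {u v : n} (huv : G.Adj u v) (hs : ∀ i, 0 < s i) (hpos : 0 ≤ T u v)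
    (hlt : T u v ^ 2 < s u * s v)
    (hnr : ¬ (G.deleteEdges {s(u, v)}).Reachable u v)
    {C : Matrix n n ℝ} (hC : IsForestCovariance s T (G.deleteEdges {s(u, v)}) C) :
    ∃ C', IsForestCovariance s T G C' := by
  set G' := G.deleteEdges {s(u, v)}
  set c := T u v / (s u * s v)
  have hsymm : C.IsSymm := hC.posDef.1
  have huv0 : C u v = 0 := by
    by_contra h
    exact hnr (hC.reachable _ _ h)
  have hvu0 : C v u = 0 := by rw [hsymm.apply, huv0]
  have hu := hs u
  have hv := hs v
  have hD : s u * s v - T u v ^ 2 ≠ 0 := by linarith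
  have hc0 : 0 ≤ c := by positivity
  have happ : ∀ i j, (C + C * (Matrix.single u v c + Matrix.single v u c) * C) i j
      = C i j + c * (C i u * C v j + C i v * C u j) := by
    intro i j
    rw [Matrix.add_apply, Matrix.mul_add, Matrix.add_mul, Matrix.add_apply, Matrix.mul_assoc,
      Matrix.mul_assoc]
    simp only [Matrix.mul_apply, Matrix.single_apply, ite_and, ite_mul, mul_ite, zero_mul, mul_zero,
      Finset.mul_sum]
    simp only [Finset.sum_ite_irrel, Finset.sum_ite_eq, Finset.sum_const_zero, Finset.mem_univ, if_true]
    ring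
  have hcross : ∀ i j, G'.Reachable i j → C i u * C v j = 0 ∧ C i v * C u j = 0 := by
    intro i j hij
    constructor <;> by_contra h
    · exact hnr (((hC.reachable _ _ (left_ne_zero_of_mul h)).symm.trans hij).trans
        (hC.reachable _ _ (right_ne_zero_of_mul h)).symm)
    · exact hnr (((hC.reachable _ _ (left_ne_zero_of_mul h)).symm.trans hij).trans
        (hC.reachable _ _ (right_ne_zero_of_mul h)).symm).symm
  have hle : G' ≤ G := G.deleteEdges_le _
  refine ⟨C + C * (Matrix.single u v c + Matrix.single v u c) * C, ?_, ?_, ?_, ?_, ?_, ?_⟩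
  · refine hC.posDef.add_cross_outer huv0 (t := T u v) ?_ ?_
    · rwa [hC.diag, hC.diag]
    · rw [hC.diag, hC.diag]
      simp only [c]
      field_simp
  · intro i
    obtain ⟨h1, h2⟩ := hcross i i (.refl i)
    rw [happ, h1, h2, hC.diag]
    ring
  · intro i j hij
    rw [happ]
    have hval : c * (s u * s v) = T u v := by simp only [c]; field_simp
    by_cases h : s(i, j) = s(u, v)
    · rcases Sym2.eq_iff.1 h with ⟨rfl, rfl⟩ | ⟨rfl, rfl⟩
      · rw [huv0, hC.diag, hC.diag, ← hval]
        ring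
      · rw [hvu0, hC.diag, hC.diag, hT.apply, ← hval]
        ring
    · have hij' : G'.Adj i j := by
        rw [SimpleGraph.deleteEdges_adj]
        exact ⟨hij, h⟩
      obtain ⟨h1, h2⟩ := hcross i j hij'.reachable
      rw [h1, h2, hC.adj _ _ hij']
      ring
  · intro i j
    rw [happ]
    have := hC.nonneg
    exact add_nonneg (this _ _) (mul_nonneg hc0 (add_nonneg (mul_nonneg (this _ _) (this _ _))
      (mul_nonneg (this _ _) (this _ _))))
  · intro i j h
    rw [happ] at h
    by_cases h0 : C i j = 0
    · by_cases h1 : C i u * C v j = 0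
      · have h2 : C i v * C u j ≠ 0 := fun h2 => h (by rw [h0, h1, h2]; ring)
        exact (((hC.reachable _ _ (left_ne_zero_of_mul h2)).mono hle).trans
          huv.symm.reachable).trans ((hC.reachable _ _ (right_ne_zero_of_mul h2)).mono hle)
      · exact (((hC.reachable _ _ (left_ne_zero_of_mul h1)).mono hle).trans
          huv.reachable).trans ((hC.reachable _ _ (right_ne_zero_of_mul h1)).mono hle)
    · exact (hC.reachable _ _ h0).mono hle
  · rw [forestPrecision_deleteEdges_add hT huv]
    set E := _ + Matrix.single v u (-(T u v / (s u * s v - T u v ^ 2))) with hE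
    set N := Matrix.single u v c + Matrix.single v u c with hN
    set P := forestPrecision s T G'
    have key : N + E + E * C * N = 0 := by
      have h1 : c - T u v / (s u * s v - T u v ^ 2)
          + 1 / s u * (T u v ^ 2 / (s u * s v - T u v ^ 2)) * s u * c = 0 := by
        simp only [c]
        field_simp
        ring
      have h2 : c - T u v / (s u * s v - T u v ^ 2)
          + 1 / s v * (T u v ^ 2 / (s u * s v - T u v ^ 2)) * s v * c = 0 := by
        simp only [c]
        field_simp
        ring
      have h3 : 1 / s u * (T u v ^ 2 / (s u * s v - T u v ^ 2))
          - T u v / (s u * s v - T u v ^ 2) * s v * c = 0 := by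
        simp only [c]
        field_simp
        ring
      have h4 : 1 / s v * (T u v ^ 2 / (s u * s v - T u v ^ 2))
          - T u v / (s u * s v - T u v ^ 2) * s u * c = 0 := by
        simp only [c]
        field_simp
        ring
      simp only [hE, hN, Matrix.add_mul, Matrix.mul_add, Matrix.single_mul_mul_single, huv0, hvu0,
        hC.diag, mul_zero, zero_mul, Matrix.single_zero, add_zero, zero_add]
      ext i j
      simp only [Matrix.add_apply, Matrix.single_apply, Matrix.zero_apply]
      split_ifs <;> linarith
    have hPC : P * C = 1 := hC.precision_mul
    calc (P + E) * (C + C * N * C) = P * C + P * C * N * C + E * C + E * C * N * C := by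
          noncomm_ring
      _ = 1 + (N + E + E * C * N) * C := by
          rw [hPC]
          noncomm_ring
      _ = 1 := by rw [key]; simp

theorem SimpleGraph.IsAcyclic.exists_isForestCovariance {s : n → ℝ} (hs : ∀ i, 0 < s i)
    {T : Matrix n n ℝ} (hT : T.IsSymm) {G : SimpleGraph n} (hG : G.IsAcyclic)
    (hpos : ∀ i j, G.Adj i j → 0 ≤ T i j) (hlt : ∀ i j, G.Adj i j → T i j ^ 2 < s i * s j) :
    ∃ C, IsForestCovariance s T G C := by
  induction G using WellFoundedLT.induction with
  | ind G ih =>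
    by_cases hbot : G = ⊥
    · subst hbot
      exact ⟨_, isForestCovariance_bot hs T⟩
    obtain ⟨u, v, huv⟩ := SimpleGraph.ne_bot_iff_exists_adj.1 hbot
    have hle : G.deleteEdges {s(u, v)} ≤ G := G.deleteEdges_le _
    have hlt' : G.deleteEdges {s(u, v)} < G := by
      refine lt_of_le_of_ne hle fun h => ?_
      rw [← h] at huv
      simp at huv
    obtain ⟨C, hC⟩ := ih _ hlt' (hG.anti hle) (fun i j h => hpos i j (hle h))
      (fun i j h => hlt i j (hle h))
    have hb := SimpleGraph.isAcyclic_iff_forall_adj_isBridge.1 hG huv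
    exact hC.of_deleteEdges hT huv hs (hpos _ _ huv) (hlt _ _ huv)
      (by rwa [SimpleGraph.isBridge_iff] at hb)

end

theorem corollary2 (p : ℕ) (S Λ : Matrix (Fin p) (Fin p) ℝ)
    (hS : S.PosSemidef) (hS_diag : ∀ i, 0 < S i i)
    (hS_lt : ∀ i j, i ≠ j → S i j < √(S i i * S j j))
    (hΛ_symm : Λ.IsSymm) (hΛ : ∀ i j, i ≠ j → 0 ≤ Λ i j)
    (hacyclic : (supportGraph (thresholded S Λ)).IsAcyclic) :
    (∃! Θ, IsOptimal S Λ Θ) ∧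
      ∀ Θ, IsOptimal S Λ Θ → (supportGraph Θ).IsAcyclic ∧ Θ = closedForm S Λ := by
  have hS_symm : S.IsSymm := hS.1
  set T := thresholded S Λ with hTdef
  set G := supportGraph T
  have hT : T.IsSymm := by
    ext i j
    simp only [hTdef, thresholded, Matrix.transpose_apply, Matrix.of_apply, hS_symm.apply,
      hΛ_symm.apply, ne_comm (a := j)]
  have hadj : ∀ {i j}, G.Adj i j ↔ i ≠ j ∧ Λ i j < S i j := by
    intro i j
    rw [supportGraph_adj hT]
    by_cases h : i ≠ j ∧ Λ i j < S i j
    · have h' : T i j = S i j - Λ i j := if_pos h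
      simp [h, h', sub_ne_zero, h.2.ne']
    · simp [hTdef, thresholded, h]
  have hTadj : ∀ {i j}, G.Adj i j → T i j = S i j - Λ i j := by
    intro i j h
    simp only [hTdef, thresholded, Matrix.of_apply, if_pos (hadj.1 h)]
  have hpos : ∀ i j, G.Adj i j → 0 ≤ T i j := by
    intro i j h
    rw [hTadj h]
    linarith [(hadj.1 h).2]
  have hlt : ∀ i j, G.Adj i j → T i j ^ 2 < S i i * S j j := by
    intro i j h
    refine (Real.lt_sqrt (hpos i j h)).1 ?_
    rw [hTadj h]
    linarith [hS_lt i j h.ne, hΛ i j h.ne]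
  obtain ⟨C, hC⟩ := hacyclic.exists_isForestCovariance (s := fun i => S i i) hS_diag hT hpos hlt
  have hK : closedForm S Λ = forestPrecision (fun i => S i i) T G := by
    ext i j
    have : BridgePair (supportGraph (thresholded S Λ)) i j ↔
        (supportGraph (thresholded S Λ)).Adj i j :=
      ⟨fun h => h.1, fun h => ⟨h, SimpleGraph.isAcyclic_iff_forall_adj_isBridge.1 hacyclic h⟩⟩
    simp only [closedForm, forestPrecision, Matrix.of_apply]
    by_cases hij : i = j
    · rw [if_pos hij, if_pos hij]
    · rw [if_neg hij, if_neg hij]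
      by_cases h : G.Adj i j
      · rw [if_pos h, if_pos (this.2 h)]
      · rw [if_neg h, if_neg fun h' => h (this.1 h')]
  set K := closedForm S Λ
  have hKC : K * C = 1 := by rw [hK]; exact hC.precision_mul
  have hKpos : K.PosDef := by
    rw [← Matrix.inv_eq_left_inv hKC]
    exact hC.posDef.inv
  have hKadj : ∀ i j, G.Adj i j → K i j = -(T i j / (S i i * S j j - T i j ^ 2)) := by
    intro i j h
    simp [hK, forestPrecision, h.ne, h]
  have hKnonadj : ∀ i j, i ≠ j → ¬ G.Adj i j → K i j = 0 := by
    intro i j hij h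
    simp [hK, forestPrecision, hij, h]
  have hKmem : K ∈ MMatrices p := by
    refine ⟨hKpos, fun i j hij => ?_⟩
    by_cases h : G.Adj i j
    · rw [hKadj i j h]
      exact neg_nonpos.2 (div_nonneg (hpos i j h) (sub_nonneg.2 (hlt i j h).le))
    · exact (hKnonadj i j hij h).le
  have hobj : ∀ Θ ∈ MMatrices p, objective S Λ Θ = -Real.log Θ.det + (Θ * C).trace
      + ∑ i, ∑ j, if i ≠ j then Θ i j * (S i j - Λ i j - C i j) else 0 := by
    intro Θ hΘ
    have hCsymm : C.IsSymm := hC.posDef.1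
    rw [objective, Matrix.trace, add_assoc, add_assoc]
    simp only [Matrix.diag, Matrix.mul_apply, ← Finset.sum_add_distrib]
    congr 1
    refine Finset.sum_congr rfl fun i _ => Finset.sum_congr rfl fun j _ => ?_
    rw [hCsymm.apply]
    by_cases hij : i = j
    · subst hij
      simp [hC.diag]
    · rw [if_pos hij, if_pos hij, abs_of_nonpos (hΘ.2 i j hij)]
      ring
  have hstrict : ∀ Θ ∈ MMatrices p, Θ ≠ K → objective S Λ K < objective S Λ Θ := by
    intro Θ hΘ hne
    have h1 := hΘ.1.log_det_lt_log_det_add hC.posDef hKC hne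
    rw [Matrix.sub_mul, Matrix.trace_sub] at h1
    have h2 : ∑ i, ∑ j, (if i ≠ j then K i j * (S i j - Λ i j - C i j) else 0) = 0 := by
      refine Finset.sum_eq_zero fun i _ => Finset.sum_eq_zero fun j _ => ?_
      split_ifs with hij
      · by_cases h : G.Adj i j
        · rw [hC.adj i j h, hTadj h]
          ring
        · rw [hKnonadj i j hij h, zero_mul]
      · rfl
    have h3 : 0 ≤ ∑ i, ∑ j, (if i ≠ j then Θ i j * (S i j - Λ i j - C i j) else 0) := by
      refine Finset.sum_nonneg fun i _ => Finset.sum_nonneg fun j _ => ?_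
      split_ifs with hij
      · refine mul_nonneg_of_nonpos_of_nonpos (hΘ.2 i j hij) ?_
        by_cases h : G.Adj i j
        · rw [hC.adj i j h, hTadj h, sub_self]
        · have : S i j ≤ Λ i j := not_lt.1 fun h' => h (hadj.2 ⟨hij, h'⟩)
          linarith [hC.nonneg i j]
      · rfl
    rw [hobj Θ hΘ, hobj K hKmem, h2]
    linarith
  have huniq : ∀ Θ, IsOptimal S Λ Θ → Θ = K := by
    intro Θ hΘ
    by_contra hne
    exact (hstrict Θ hΘ.1 hne).not_ge (hΘ.2 K hKmem)
  refine ⟨⟨K, ⟨hKmem, fun Θ hΘ => ?_⟩, huniq⟩, fun Θ hΘ => ?_⟩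
  · by_cases h : Θ = K
    · rw [h]
    · exact (hstrict Θ hΘ h).le
  · obtain rfl := huniq Θ hΘ
    refine ⟨hacyclic.anti fun i j h => ?_, rfl⟩
    obtain ⟨hij, h⟩ := (supportGraph_adj hKpos.1 i j).1 h
    by_contra hn
    exact h (hKnonadj i j hij hn)
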